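/- **Corollary 2.2 (representability in the grand-canonical case).** Let $d\ge 1$ and let $w:\mathbb R^d\to\mathbb R\cup\{+\infty\}$ be an even, lower semi-continuous function such that, for some constants $\kappa>0$, $r_0\ge 0$, $0\le\alpha\le\infty$ and $s>d$, - ($w$ is stable) $\sum_{1\le j<k\le N} w(x_j-x_k)\ge -\kappa N$ for all $N\in\mathbb N$ and $x_1,\dots,x_N\in\mathbb R^d$; - ($w$ is upper regular) $w(x)\le \kappa\Big(\mathbf 1(|x|<r_0)\big(\tfrac{r_0}{|x|}\big)^{\alpha}+\tfrac{1}{1+|x|^s}\Big)$ for all $x\in\mathbb R^d$, where for $\alpha=\infty$ the first term is $+\infty$ on $\{|x|<r_0\}$ and $0$ elsewhere, and at $x=0$ with $r_0>0$ the factor $(r_0/|x|)^\alpha$ is $+\infty$ if $\alpha>0$ and $1$ if $\alpha=0$. A grand-canonical state is a family $\mathbb P=(\mathbb P_n)_{n\ge0}$ of symmetric positive Borel measures $\mathbb P_n$ on $(\mathbb R^d)^n$ with $\sum_{n\ge 0}\mathbb P_n((\mathbb R^d)^n)=1$. Its one-particle density is $\rho_{\mathbb P}=\sum_{n\ge1}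 n\int_{(\mathbb R^d)^{n-1}}\mathrm d\mathbb P_n(\cdot,x_2,\dots,x_n)$, its interaction energy is $$\mathcal U(\mathbb P)=\sum_{n\ge2}\int_{(\mathbb R^d)^n}\sum_{1\le j<k\le n}w(x_j-x_k)\,\mathrm d\mathbb P_n(x_1,\dots,x_n),$$ and its entropy is $\mathcal S(\mathbb P)=-\mathbb P_0\log\mathbb P_0-\sum_{n\ge1}\int_{(\mathbb R^d)^n}\mathbb P_n\log(n!\,\mathbb P_n)$, with $\mathcal S(\mathbb P)=-\infty$ if some $\mathbb P_n$ is not absolutely continuous with respect to Lebesgue measure. For $T\ge0$ and $0\le\rho\in L^1(\mathbb R^d)$ set $$G_T[\rho]=\inf_{\mathbb P:\ \rho_{\mathbb P}=\rho}\big(\mathcal U(\mathbb P)-T\,\mathcal S(\mathbb P)\big),$$ where the entropy term is absent for $T=0$. Assume that $w$ has no hard core, that is, $\alpha<\infty$, and let $0\le\rho\in L^1(\mathbb R^d)$. Then $G_0[\rho]<\infty$. If furthermore $\int_{\mathbb R^d}\rho|\log\rho|<\infty$, then $G_T[\rho]<\infty$ for all $T>0$. -/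

import Mathlib

open MeasureTheory
open scoped ENNReal

noncomputable section

namespace ClassicalGas

/-- The one-particle space `ℝ^d` with its Euclidean norm and Lebesgue measure. A configuration of
`n` particles is an element of `Fin n → Space d`, whose `volume` is the Lebesgue measure on
`(ℝ^d)^n` (for `n = 0`, the unit mass at the single point). -/
abbrev Space (d : ℕ) : Type := EuclideanSpace ℝ (Fin d)

/-- `∫ f dμ` for a function with values in `[-∞, +∞]`: the integral of the positive part minus
the integral of the negative part. It is meaningful when one of the two is finite; the
indeterminate form `∞ - ∞` is read as `+∞`. -/
def extInt {X : Type*} [MeasurableSpace X] (μ : Measure X) (f : X → EReal) : EReal :=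
  -(((∫⁻ x, (-f x).toENNReal ∂μ : ℝ≥0∞) : EReal) - ((∫⁻ x, (f x).toENNReal ∂μ : ℝ≥0∞) : EReal))

/-- `∑ₙ f n` for terms in `[-∞, +∞]`: the sum of the positive parts minus the sum of the negative
parts, with `∞ - ∞` read as `+∞`. -/
def extSum (f : ℕ → EReal) : EReal :=
  -(((∑' n, (-f n).toENNReal : ℝ≥0∞) : EReal) - ((∑' n, (f n).toENNReal : ℝ≥0∞) : EReal))

/-- The interaction `∑_{j < k} w (x_j - x_k)` of a configuration. -/
def pairEnergy {d n : ℕ} (w : Space d → EReal) (x : Fin n → Space d) : EReal :=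
  ∑ j : Fin n, ∑ k ∈ Finset.Ioi j, w (x j - x k)

/-- The factor `(r₀ / |x|) ^ α` for `0 ≤ α ≤ ∞`, used only for `|x| < r₀`: it is `+∞` when
`α = ∞`, and at `x = 0` it is `+∞` when `α > 0` and `1` when `α = 0`. -/
def coreFactor {d : ℕ} (r₀ : ℝ) (α : ℝ≥0∞) (x : Space d) : ℝ≥0∞ :=
  if α = ⊤ then ⊤ else (ENNReal.ofReal r₀ / ENNReal.ofReal ‖x‖) ^ α.toReal

/-- The function `κ (1(|x| < r₀) (r₀ / |x|) ^ α + 1 / (1 + |x| ^ s))`. -/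
def upperProfile {d : ℕ} (κ r₀ : ℝ) (α : ℝ≥0∞) (s : ℝ) (x : Space d) : ℝ≥0∞ :=
  ENNReal.ofReal κ *
    ((if ‖x‖ < r₀ then coreFactor r₀ α x else 0) + ENNReal.ofReal (1 / (1 + ‖x‖ ^ s)))

/-- `w : ℝ^d → ℝ ∪ {+∞}` is an even, lower semicontinuous, stable and upper regular pair
potential with constants `κ > 0`, `r₀ ≥ 0`, `α ∈ [0, ∞]`, `s > d`. It has no hard core when
`α < ∞`. -/
structure ShortRange {d : ℕ} (w : Space d → EReal) (κ r₀ : ℝ) (α : ℝ≥0∞) (s : ℝ) : Prop where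
  ne_bot : ∀ x, w x ≠ ⊥
  even : ∀ x, w (-x) = w x
  lsc : LowerSemicontinuous w
  kappa_pos : 0 < κ
  stable : ∀ (N : ℕ) (x : Fin N → Space d), ((-(κ * N) : ℝ) : EReal) ≤ pairEnergy w x
  r_nonneg : 0 ≤ r₀
  s_gt : (d : ℝ) < s
  upper : ∀ x, w x ≤ (upperProfile κ r₀ α s x : EReal)

/-- A grand-canonical state: a family of symmetric positive Borel measures `P n` on `(ℝ^d)^n`,
`n ≥ 0`, of total mass one. -/
structure State (d : ℕ) where
  P : (n : ℕ) → Measure (Fin n → Space d)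
  symmetric : ∀ (n : ℕ) (σ : Equiv.Perm (Fin n)), (P n).map (fun x i => x (σ i)) = P n
  total_mass : ∑' n, P n Set.univ = 1

/-- The one-particle density `∑_{n ≥ 1} n ∫ dP_n (·, x_2, …, x_n)` of a state, as a measure on
`ℝ^d` (the index is shifted by one). -/
def State.density {d : ℕ} (S : State d) : Measure (Space d) :=
  Measure.sum fun n : ℕ => ((n + 1 : ℕ) : ℝ≥0∞) • (S.P (n + 1)).map (fun x => x 0)

/-- The interaction energy `∫ ∑_{j < k} w (x_j - x_k) dμ` of a positive measure on `(ℝ^d)^n`. -/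
def interactionN {d : ℕ} (w : Space d → EReal) (n : ℕ) (μ : Measure (Fin n → Space d)) : EReal :=
  extInt μ (pairEnergy w)

open Classical in
/-- The entropy `-∫ μ(x) log (n! μ(x)) dx` of a positive measure on `(ℝ^d)^n`, where `μ(x)` is the
Lebesgue density; it is `-∞` if `μ` is not absolutely continuous. -/
def entropyN {d : ℕ} (n : ℕ) (μ : Measure (Fin n → Space d)) : EReal :=
  if μ ≪ volume then
    -extInt volume (fun x : Fin n → Space d =>
      (((μ.rnDeriv volume x).toReal *
        Real.log ((n.factorial : ℝ) * (μ.rnDeriv volume x).toReal) : ℝ) : EReal))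
  else ⊥

/-- The interaction energy `∑ₙ 𝒰ₙ(Pₙ)`; the terms `n = 0, 1` vanish. -/
def State.interaction {d : ℕ} (w : Space d → EReal) (S : State d) : EReal :=
  extSum fun n => interactionN w n (S.P n)

/-- The entropy `∑ₙ 𝒮ₙ(Pₙ)` (here `∞ - ∞` is read as `-∞`). -/
def State.entropy {d : ℕ} (S : State d) : EReal :=
  -extSum fun n => -entropyN n (S.P n)

/-- The free energy `𝒰(P) - T 𝒮(P)`, which is just `𝒰(P)` for `T = 0`. It is written
`-(T 𝒮(P) - 𝒰(P))` so that an indeterminate `∞ - ∞` is read as `+∞`. -/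
def State.freeEnergy {d : ℕ} (w : Space d → EReal) (T : ℝ) (S : State d) : EReal :=
  -((T : EReal) * S.entropy - S.interaction w)

/-- `G_T[ρ]`: the infimum of the free energy over all grand-canonical states with one-particle
density `ρ` (it is `+∞` if there is none). -/
def G {d : ℕ} (w : Space d → EReal) (T : ℝ) (ρ : Space d → ℝ) : EReal :=
  sInf {g : EReal | ∃ S : State d,
    S.density = volume.withDensity (fun x => ENNReal.ofReal (ρ x)) ∧ g = S.freeEnergy w T}

end ClassicalGas

end

/-! Let `μ` be the measure with density `ρ`. Only a trial state of finite free energy is needed, and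
without hard core the pair interaction is bounded above at distances at least `δ > 0`. So particles
are kept apart: `exists_shells` cuts `μ` into `2n` radial shells of equal mass `m`, with `n`
exceeding the total mass. Adjacent shells may touch, but shells of equal parity are at a positive
distance. For each parity, one particle is placed in each of its `n` shells, independently with law
proportional to `μ`, and the labels are symmetrised; the two parities together recover all of `μ`.
Normalised to density `ρ`, this `n`-particle measure has mass `2m ≤ 1`, and the vacuum takes the
rest. The energy is not `+∞` by separation (`interactionN_ne_top`). The entropy is not `-∞` because
the measure is at most a constant times `μ^{⊗n}` (`assignMeasure_le`, `entropyN_ne_bot`). -/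

/-! ### Radial shells of equal mass -/

section Shells

open Set Filter Topology

/-- Quantiles of a finite measure without atoms on the real line. -/
theorem exists_measureReal_Iic_eq (ν : Measure ℝ) [IsFiniteMeasure ν] [NullSingletonClass ν] {c : ℝ}
    (hc : 0 < c) (hc' : c < ν.real univ) : ∃ t, ν.real (Iic t) = c := by
  have hint : ∀ a b : ℝ, IntervalIntegrable (fun _ => (1 : ℝ)) ν a b := fun a b => by simp
  have hcont : Continuous fun t => ν.real (Iic t) := by
    have h : (fun t => ν.real (Iic t)) = fun t => ν.real (Iic 0) + ∫ _ in (0 : ℝ)..t, (1 : ℝ) ∂ν := by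
      ext t
      have h1 := intervalIntegral.integral_Iic_sub_Iic (μ := ν) (f := fun _ : ℝ => (1 : ℝ))
        (a := 0) (b := t) (by simp [IntegrableOn]) (by simp [IntegrableOn])
      simp only [integral_const, smul_eq_mul, mul_one, measureReal_restrict_apply_univ] at h1
      linarith
    rw [h]
    exact continuous_const.add (intervalIntegral.continuous_primitive hint 0)
  have htop : Tendsto (fun t => ν.real (Iic t)) atTop (𝓝 (ν.real univ)) :=
    (ENNReal.tendsto_toReal (measure_ne_top _ _)).comp (tendsto_measure_Iic_atTop ν)
  have hbot : Tendsto (fun t => ν.real (Iic t)) atBot (𝓝 0) := by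
    have h : Tendsto (fun t => ν (Iic t)) atBot (𝓝 (ν (⋂ t, Iic t))) :=
      tendsto_measure_iInter_atBot (fun _ => measurableSet_Iic.nullMeasurableSet)
        (fun _ _ h => Iic_subset_Iic.2 h) ⟨0, measure_ne_top _ _⟩
    rw [iInter_Iic_eq_empty_iff.2 (by simp [not_bddBelow_univ]), measure_empty] at h
    exact (ENNReal.tendsto_toReal ENNReal.zero_ne_top).comp h
  obtain ⟨a, ha⟩ := (hbot.eventually (gt_mem_nhds hc)).exists
  obtain ⟨b, hb⟩ := (htop.eventually (lt_mem_nhds hc')).exists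
  exact mem_range_of_exists_le_of_exists_ge hcont ⟨a, ha.le⟩ ⟨b, hb.le⟩

variable {E : Type*} [NormedAddCommGroup E] [MeasurableSpace E] [BorelSpace E]

/-- A finite measure that does not charge spheres is cut into `K` radial shells of equal mass, and
two shells that are not adjacent are at a positive distance. -/
theorem exists_shells (μ : Measure E) [IsFiniteMeasure μ] [NullSingletonClass (μ.map fun x => ‖x‖)]
    (hμ : μ ≠ 0) {K : ℕ} (hK : 0 < K) :
    ∃ A : ℕ → Set E, (∀ i, MeasurableSet (A i)) ∧ (∀ i < K, μ (A i) = μ univ / K) ∧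
      ∑ i ∈ Finset.range K, μ.restrict (A i) = μ ∧
      ∃ δ > 0, ∀ i j, i + 2 ≤ j → j < K → ∀ x ∈ A i, ∀ y ∈ A j, δ ≤ ‖x - y‖ := by
  set M := μ.real univ with hM
  have hMpos : 0 < M := by
    refine ENNReal.toReal_pos ?_ (measure_ne_top _ _)
    simpa using hμ
  have hK' : (0 : ℝ) < K := by exact_mod_cast hK
  have hmeas : Measurable fun x : E => ‖x‖ := measurable_norm
  -- Only `i < K` is required: a measure of unbounded support has no radius that leaves zero mass
  -- outside. For `i = 0` the radius is negative, so that the origin is included.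
  have hex : ∀ i : ℕ, ∃ t : ℝ, i < K → μ.real {x | t < ‖x‖} = M - i * (M / K) := by
    intro i
    rcases Nat.eq_zero_or_pos i with rfl | hi
    · refine ⟨-1, fun _ => ?_⟩
      have : {x : E | -1 < ‖x‖} = univ := by
        ext x; simpa using (by linarith [norm_nonneg x] : -1 < ‖x‖)
      simp [this, hM]
    · by_cases hiK : i < K
      · have hi' : (0 : ℝ) < i := by exact_mod_cast hi
        have hiK' : (i : ℝ) < K := by exact_mod_cast hiK
        have huniv : (μ.map fun x => ‖x‖).real univ = M := by
          rw [map_measureReal_apply hmeas MeasurableSet.univ, preimage_univ]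
        obtain ⟨t, ht⟩ := exists_measureReal_Iic_eq (μ.map fun x => ‖x‖) (c := i * (M / K))
          (by positivity) (by rw [huniv, mul_div_assoc', div_lt_iff₀ hK']; nlinarith)
        refine ⟨t, fun _ => ?_⟩
        rw [map_measureReal_apply hmeas measurableSet_Iic] at ht
        have : {x : E | t < ‖x‖} = ((fun x => ‖x‖) ⁻¹' Iic t)ᶜ := by ext x; simp
        rw [this, measureReal_compl (hmeas measurableSet_Iic), ht]
      · exact ⟨0, fun h => absurd h hiK⟩
  choose t ht using hex
  have hstep : 0 < M / K := by positivity
  have hlt : ∀ i j, i < j → j < K → t i < t j := by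
    intro i j hij hj
    by_contra! hle
    have h1 : μ.real {x | t i < ‖x‖} ≤ μ.real {x | t j < ‖x‖} :=
      measureReal_mono fun x hx => lt_of_le_of_lt hle hx
    rw [ht i (hij.trans hj), ht j hj] at h1
    have : (i : ℝ) < j := by exact_mod_cast hij
    nlinarith
  -- Since `D K = ∅`, the last shell `D (K - 1) \ D K` is the whole exterior region.
  set D : ℕ → Set E := fun i => if i < K then {x | t i < ‖x‖} else ∅ with hD
  have hDmeas : ∀ i, MeasurableSet (D i) := by
    intro i
    simp only [hD]
    split_ifs
    · exact measurableSet_lt measurable_const hmeas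
    · exact MeasurableSet.empty
  have hDlt : ∀ i, i < K → D i = {x | t i < ‖x‖} := fun i hi => by simp [hD, hi]
  have hDsub : ∀ i, D (i + 1) ⊆ D i := by
    intro i x hx
    by_cases hi : i + 1 < K
    · rw [hDlt _ hi] at hx
      rw [hDlt _ (by omega)]
      exact (hlt i (i + 1) (by omega) hi).trans hx
    · simp [hD, hi] at hx
  have hDreal : ∀ i ≤ K, μ.real (D i) = M - i * (M / K) := by
    intro i hi
    rcases hi.lt_or_eq with h | rfl
    · rw [hDlt _ h, ht _ h]
    · have : (i : ℝ) * (M / i) = M := by field_simp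
      simp [hD, this]
  have hDzero : μ.restrict (D 0) = μ := by
    refine Measure.restrict_eq_self_of_ae_mem ?_
    rw [ae_iff]
    change μ (D 0)ᶜ = 0
    rw [← measureReal_eq_zero_iff, measureReal_compl (hDmeas 0),
      hDreal 0 hK.le]
    simp [hM]
  have htel : ∀ k, ∑ i ∈ Finset.range k, μ.restrict (D i \ D (i + 1)) + μ.restrict (D k)
      = μ.restrict (D 0) := by
    intro k
    induction k with
    | zero => simp
    | succ k ih =>
      rw [Finset.sum_range_succ, add_assoc, ← ih]
      congr 1
      have h := Measure.restrict_inter_add_sdiff (μ := μ) (D k) (hDmeas (k + 1))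
      rw [inter_eq_self_of_subset_right (hDsub k)] at h
      rw [add_comm, h]
  -- `δ` is the least of finitely many positive radius gaps, built by induction.
  have hgap : ∀ K', ∃ δ > 0, ∀ i, i + 1 < K' → K' ≤ K → δ ≤ t (i + 1) - t i := by
    intro K'
    induction K' with
    | zero => exact ⟨1, one_pos, by simp⟩
    | succ k ih =>
      obtain ⟨δ, hδ, h⟩ := ih
      by_cases hk : 0 < k ∧ k + 1 ≤ K
      · obtain ⟨hk0, hkK⟩ := hk
        obtain ⟨l, rfl⟩ : ∃ l, k = l + 1 := ⟨k - 1, by omega⟩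
        refine ⟨min δ (t (l + 1) - t l), lt_min hδ ?_, fun i hi hle => ?_⟩
        · linarith [hlt l (l + 1) (by omega) (by omega)]
        · rcases Nat.lt_or_ge (i + 1) (l + 1) with h1 | h1
          · exact (min_le_left _ _).trans (h i h1 (by omega))
          · obtain rfl : i = l := by omega
            exact min_le_right _ _
      · exact ⟨δ, hδ, fun i hi hle => absurd ⟨by omega, hle⟩ hk⟩
  obtain ⟨δ, hδ, hgap⟩ := hgap K
  refine ⟨fun i => D i \ D (i + 1), fun i => (hDmeas i).diff (hDmeas _), ?_, ?_, δ, hδ, ?_⟩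
  · intro i hi
    rw [← ENNReal.toReal_eq_toReal_iff' (measure_ne_top _ _)
      (ENNReal.div_ne_top (measure_ne_top _ _) (by exact_mod_cast hK.ne')), ← measureReal_def,
      measureReal_sdiff (hDsub i) (hDmeas _), hDreal i hi.le, hDreal (i + 1) hi,
      ENNReal.toReal_div, ← measureReal_def, ← hM]
    push_cast
    simp
    ring
  · have := htel K
    rw [hDzero] at this
    simpa [hD] using this
  · intro i j hij hj x hx y hy
    beta_reduce at hx hy
    rw [hDlt i (by omega), hDlt (i + 1) (by omega)] at hx
    have hy := hy.1
    rw [hDlt j hj] at hy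
    simp only [Set.mem_sdiff, Set.mem_ofPred_eq, not_lt] at hx hy
    -- The shell `i + 1` lies between: `‖x‖ ≤ t (i + 1)` and `t (i + 2) ≤ t j < ‖y‖`.
    have h1 : t (i + 2) ≤ t j := by
      rcases hij.eq_or_lt with h | h
      · rw [h]
      · exact (hlt _ _ h hj).le
    have h2 := hgap (i + 1) (by omega) le_rfl
    have h3 := abs_norm_sub_norm_le x y
    have h4 := neg_abs_le (‖x‖ - ‖y‖)
    have : t (i + 1 + 1) = t (i + 2) := rfl
    linarith [hx.2]

end Shells

/-! ### Symmetrised products over the shells -/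

noncomputable section
namespace ClassicalGas

section ShellMeasure

variable {E : Type*} [MeasurableSpace E] {n : ℕ}

/-- Relabelling the coordinates of a product measure. -/
theorem map_comp_perm_pi (ν : Fin n → Measure E) [∀ i, SigmaFinite (ν i)]
    (τ : Equiv.Perm (Fin n)) :
    (Measure.pi ν).map (fun x i => x (τ i)) = Measure.pi fun i => ν (τ i) := by
  refine (Measure.pi_eq fun s hs => ?_).symm
  rw [Measure.map_apply (by fun_prop) (MeasurableSet.univ_pi hs)]
  have : (fun (x : Fin n → E) i => x (τ i)) ⁻¹' Set.univ.pi s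
      = Set.univ.pi fun i => s (τ.symm i) := by
    ext x
    simp only [Set.mem_preimage, Set.mem_univ_pi]
    exact ⟨fun h i => by simpa using h (τ.symm i), fun h i => by simpa using h (τ i)⟩
  rw [this, Measure.pi_pi, ← Equiv.prod_comp τ]
  simp

/-- The sum over `e = 0, 1` and over all the ways to assign `n` particles to the sets `B i e`,
one particle to each `i`, of the product of the restrictions of `μ`. -/
def assignMeasure (μ : Measure E) (B : Fin n → Fin 2 → Set E) : Measure (Fin n → E) :=
  ∑ σ : Equiv.Perm (Fin n), ∑ e : Fin 2, Measure.pi fun i => μ.restrict (B (σ i) e)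

variable (μ : Measure E) [IsFiniteMeasure μ] {B : Fin n → Fin 2 → Set E}

theorem map_comp_perm_assignMeasure (τ : Equiv.Perm (Fin n)) :
    (assignMeasure μ B).map (fun x i => x (τ i)) = assignMeasure μ B := by
  have hτ : Measurable fun (x : Fin n → E) i => x (τ i) := by fun_prop
  simp only [assignMeasure, Measure.map_finset_sum hτ.aemeasurable]
  conv_rhs => rw [← Equiv.sum_comp (Equiv.mulRight τ)]
  refine Finset.sum_congr rfl fun σ _ => Finset.sum_congr rfl fun e _ => ?_
  rw [map_comp_perm_pi (fun i => μ.restrict (B (σ i) e)) τ]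
  rfl

theorem map_eval_assignMeasure (i j : Fin n) :
    (assignMeasure μ B).map (fun x => x i) = (assignMeasure μ B).map fun x => x j := by
  conv_rhs => rw [← map_comp_perm_assignMeasure μ (Equiv.swap i j)]
  rw [Measure.map_map (by fun_prop) (by fun_prop)]
  congr 1
  ext x
  simp

variable {m : ℝ≥0∞}

theorem assignMeasure_univ (hm : ∀ i e, μ (B i e) = m) :
    assignMeasure μ B Set.univ = n.factorial * (2 * m ^ n) := by
  simp [assignMeasure, Measure.finsetSum_apply, Measure.pi_univ, hm, Fintype.card_perm]
  ring

/-- In each product the `n - 1` integrated coordinates contribute `m ^ (n - 1)`. For fixed `σ`,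
summing over `j` visits each `i` once, so with both values of `e` the restrictions add up to `μ`;
there are `n!` choices of `σ`. -/
theorem sum_map_eval_assignMeasure (hm : ∀ i e, μ (B i e) = m)
    (hsum : ∑ i, ∑ e, μ.restrict (B i e) = μ) :
    ∑ j, (assignMeasure μ B).map (fun x => x j) = (n.factorial * m ^ (n - 1)) • μ := by
  have h1 : ∀ j : Fin n, (assignMeasure μ B).map (fun x => x j)
      = ∑ σ : Equiv.Perm (Fin n), ∑ e : Fin 2, m ^ (n - 1) • μ.restrict (B (σ j) e) := by
    intro j
    have hj : Measurable fun x : Fin n → E => x j := by fun_prop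
    simp only [assignMeasure, Measure.map_finset_sum hj.aemeasurable]
    refine Finset.sum_congr rfl fun σ _ => Finset.sum_congr rfl fun e _ => ?_
    have := Measure.pi_map_eval (fun i => μ.restrict (B (σ i) e)) j
    simp only [Measure.restrict_apply_univ, hm, Finset.prod_const, Finset.card_erase_of_mem
      (Finset.mem_univ j), Finset.card_univ, Fintype.card_fin] at this
    exact this
  simp only [h1]
  rw [Finset.sum_comm]
  have h2 : ∀ σ : Equiv.Perm (Fin n),
      ∑ j, ∑ e : Fin 2, m ^ (n - 1) • μ.restrict (B (σ j) e) = m ^ (n - 1) • μ := by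
    intro σ
    rw [Equiv.sum_comp σ (fun i => ∑ e : Fin 2, m ^ (n - 1) • μ.restrict (B i e))]
    simp only [← Finset.smul_sum, hsum]
  simp only [h2, Finset.sum_const, Finset.card_univ, Fintype.card_perm, Fintype.card_fin]
  rw [← Nat.cast_smul_eq_nsmul ℝ≥0∞, smul_smul]

/-- Each of the `2 n!` terms is the restriction of the full product measure to a box. -/
theorem assignMeasure_le :
    assignMeasure μ B ≤ (n.factorial * 2 : ℝ≥0∞) • Measure.pi fun _ => μ := by
  have h : ∀ (σ : Equiv.Perm (Fin n)) (e : Fin 2),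
      (Measure.pi fun i => μ.restrict (B (σ i) e)) ≤ Measure.pi fun _ => μ := by
    intro σ e
    rw [← Measure.restrict_pi_pi (fun _ => μ)]
    exact Measure.restrict_le_self
  calc assignMeasure μ B
      ≤ ∑ _σ : Equiv.Perm (Fin n), ∑ _e : Fin 2, Measure.pi fun _ => μ :=
        Finset.sum_le_sum fun σ _ => Finset.sum_le_sum fun e _ => h σ e
    _ = _ := by
        simp only [Finset.sum_const, Finset.card_univ, Fintype.card_perm, Fintype.card_fin]
        rw [← Nat.cast_smul_eq_nsmul ℝ≥0∞, ← Nat.cast_smul_eq_nsmul ℝ≥0∞, smul_smul]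
        simp

/-- Within one term all particles share the same `e` and `σ` is injective, so sets with different
`e` are never compared. -/
theorem ae_assignMeasure {p : E → E → Prop} (hB : ∀ i e, MeasurableSet (B i e))
    (h : ∀ e i j, i ≠ j → ∀ x ∈ B i e, ∀ y ∈ B j e, p x y) :
    ∀ᵐ x ∂assignMeasure μ B, ∀ j k, j ≠ k → p (x j) (x k) := by
  have hae : ∀ (σ : Equiv.Perm (Fin n)) (e : Fin 2),
      ∀ᵐ x ∂(Measure.pi fun i => μ.restrict (B (σ i) e)), ∀ j k, j ≠ k → p (x j) (x k) := by
    intro σ e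
    rw [← Measure.restrict_pi_pi (fun _ => μ)]
    filter_upwards [ae_restrict_mem (MeasurableSet.univ_pi fun i => hB (σ i) e)] with x hx j k hjk
    exact h e (σ j) (σ k) (σ.injective.ne hjk) _ (hx j trivial) _ (hx k trivial)
  rw [ae_iff]
  simp only [assignMeasure, Measure.finsetSum_apply]
  exact Finset.sum_eq_zero fun σ _ => Finset.sum_eq_zero fun e _ => ae_iff.1 (hae σ e)

end ShellMeasure
end ClassicalGas
end

/-! ### Bounds on energy and entropy -/

noncomputable section
namespace ClassicalGas

section Finiteness

/-- In `EReal`, `⊤ - ⊤ = ⊥`, so finiteness of the positive part `b` alone excludes `+∞`; the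
negative part may be infinite. -/
theorem neg_sub_ne_top {a b : ℝ≥0∞} (hb : b ≠ ⊤) : -((a : EReal) - (b : EReal)) ≠ ⊤ := by
  rw [Ne, EReal.neg_eq_top_iff, sub_eq_add_neg, EReal.add_eq_bot_iff, EReal.neg_eq_bot_iff]
  simp [hb]

theorem extInt_ne_top {X : Type*} [MeasurableSpace X] {μ : Measure X} {f : X → EReal}
    (h : ∫⁻ x, (f x).toENNReal ∂μ ≠ ⊤) : extInt μ f ≠ ⊤ :=
  neg_sub_ne_top h

theorem extSum_ne_top {f : ℕ → EReal} {N : ℕ} (hf : ∀ n, f n ≠ ⊤) (h : ∀ n, N < n → f n = 0) :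
    extSum f ≠ ⊤ := by
  refine neg_sub_ne_top ?_
  rw [tsum_eq_sum (s := Finset.range (N + 1))
    (fun n hn => by rw [h n (by simpa using hn)]; simp)]
  exact ENNReal.sum_ne_top.2 fun n _ => by simpa [EReal.toENNReal_eq_top_iff] using hf n

variable {d : ℕ}

theorem interactionN_zero (w : Space d → EReal) (n : ℕ) : interactionN w n 0 = 0 := by
  simp [interactionN, extInt]

theorem entropyN_zero (n : ℕ) : entropyN n (0 : Measure (Fin n → Space d)) = 0 := by
  have h : (0 : Measure (Fin n → Space d)) ≪ volume := Measure.AbsolutelyContinuous.zero _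
  have h0 : (0 : Measure (Fin n → Space d)).rnDeriv volume =ᵐ[volume] 0 := Measure.rnDeriv_zero _
  have h1 : ∀ σ : EReal → EReal, σ 0 = 0 → ∫⁻ x, (σ (((Measure.rnDeriv 0 volume x).toReal *
      Real.log (n.factorial * (Measure.rnDeriv 0 volume x).toReal) : ℝ) : EReal)).toENNReal
        ∂(volume : Measure (Fin n → Space d)) = 0 := by
    intro σ hσ
    rw [lintegral_congr_ae (g := fun _ => 0), lintegral_zero]
    filter_upwards [h0] with x hx
    simp [hx, hσ]
  rw [entropyN, if_pos h, extInt, h1 (fun z => -z) neg_zero, h1 (fun z => z) rfl]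
  simp

/-- The free energy is below `+∞` as soon as the energy and entropy of each component are not
infinite in the wrong direction and the particle number is bounded. -/
theorem State.freeEnergy_lt_top {w : Space d → EReal} {T : ℝ} (hT : 0 ≤ T) {S : State d} {N : ℕ}
    (hN : ∀ n, N < n → S.P n = 0) (hU : ∀ n, interactionN w n (S.P n) ≠ ⊤)
    (hS : 0 < T → ∀ n, entropyN n (S.P n) ≠ ⊥) : S.freeEnergy w T < ⊤ := by
  have hU' : S.interaction w ≠ ⊤ :=
    extSum_ne_top hU fun n hn => by rw [hN n hn, interactionN_zero]
  -- At `T = 0` the product vanishes even for entropy `⊥`, since `0 * ⊥ = 0` in `EReal`.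
  have hTS : (T : EReal) * S.entropy ≠ ⊥ := by
    rcases hT.eq_or_lt with rfl | hT
    · simp
    · have : S.entropy ≠ ⊥ := by
        rw [State.entropy, Ne, EReal.neg_eq_bot_iff]
        refine extSum_ne_top (fun n => ?_) fun n hn => by rw [hN n hn, entropyN_zero, neg_zero]
        rw [Ne, EReal.neg_eq_top_iff]
        exact hS hT n
      rw [Ne, EReal.mul_eq_bot]
      simp [this, hT, hT.le]
  rw [lt_top_iff_ne_top, State.freeEnergy, Ne, EReal.neg_eq_top_iff, sub_eq_add_neg,
    EReal.add_eq_bot_iff, EReal.neg_eq_bot_iff]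
  simp [hU', hTS]

/-- Away from the origin the upper profile without hard core is bounded. -/
theorem exists_upperProfile_le (κ r₀ : ℝ) {α : ℝ≥0∞} (hα : α < ⊤) (s : ℝ) {δ : ℝ} (hδ : 0 < δ) :
    ∃ b : ℝ≥0∞, b ≠ ⊤ ∧ ∀ x : Space d, δ ≤ ‖x‖ → upperProfile κ r₀ α s x ≤ b := by
  refine ⟨ENNReal.ofReal κ * ((ENNReal.ofReal r₀ / ENNReal.ofReal δ) ^ α.toReal + 1), ?_, ?_⟩
  · refine ENNReal.mul_ne_top ENNReal.ofReal_ne_top (ENNReal.add_ne_top.2 ⟨?_, ENNReal.one_ne_top⟩)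
    refine ENNReal.rpow_ne_top_of_nonneg ENNReal.toReal_nonneg (ENNReal.div_ne_top
      ENNReal.ofReal_ne_top ?_)
    simpa using hδ
  · intro x hx
    refine mul_le_mul_right ?_ _
    refine add_le_add ?_ ?_
    · split_ifs
      · rw [coreFactor, if_neg hα.ne]
        gcongr
      · exact zero_le
    · rw [← ENNReal.ofReal_one]
      refine ENNReal.ofReal_le_ofReal ?_
      have : 0 ≤ ‖x‖ ^ s := by positivity
      rw [div_le_one (by positivity)]
      linarith

theorem coe_ennreal_finsetSum {ι : Type*} (s : Finset ι) (f : ι → ℝ≥0∞) :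
    ((∑ i ∈ s, f i : ℝ≥0∞) : EReal) = ∑ i ∈ s, (f i : EReal) :=
  map_sum (⟨⟨(↑), EReal.coe_ennreal_zero⟩, EReal.coe_ennreal_add⟩ : ℝ≥0∞ →+ EReal) f s

/-- The interaction energy of particles that stay at a distance `δ` is below `+∞`. -/
theorem interactionN_ne_top {w : Space d → EReal} {κ r₀ s : ℝ} {α : ℝ≥0∞}
    (hw : ShortRange w κ r₀ α s) (hα : α < ⊤) {n : ℕ} {Q : Measure (Fin n → Space d)}
    [IsFiniteMeasure Q] {δ : ℝ} (hδ : 0 < δ)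
    (hQ : ∀ᵐ x ∂Q, ∀ j k, j ≠ k → δ ≤ ‖x j - x k‖) : interactionN w n Q ≠ ⊤ := by
  obtain ⟨b, hb, hle⟩ := exists_upperProfile_le (d := d) κ r₀ hα s hδ
  set c : ℝ≥0∞ := ∑ j : Fin n, ∑ _k ∈ Finset.Ioi j, b with hc
  have hctop : c ≠ ⊤ := ENNReal.sum_ne_top.2 fun j _ => ENNReal.sum_ne_top.2 fun k _ => hb
  refine extInt_ne_top (ne_top_of_le_ne_top (b := ∫⁻ _, c ∂Q) ?_ (lintegral_mono_ae ?_))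
  · rw [lintegral_const]
    exact ENNReal.mul_ne_top hctop (measure_ne_top _ _)
  · filter_upwards [hQ] with x hx
    rw [← EReal.toENNReal_coe (x := c)]
    refine EReal.toENNReal_le_toENNReal ?_
    have : ((c : ℝ≥0∞) : EReal) = ∑ j : Fin n, ∑ _k ∈ Finset.Ioi j, (b : EReal) := by
      simp only [hc, coe_ennreal_finsetSum]
    rw [this]
    refine Finset.sum_le_sum fun j _ => Finset.sum_le_sum fun k hk => (hw.upper _).trans ?_
    exact EReal.coe_ennreal_le_coe_ennreal_iff.2 (hle _ (hx j k (Finset.mem_Ioi.1 hk).ne))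

/-- A product of measures with density has the product density. -/
theorem pi_withDensity_ofReal {E : Type*} [MeasurableSpace E] (ν : Measure E) [SigmaFinite ν]
    {f : E → ℝ} (hf : Integrable f ν) (hf0 : 0 ≤ f) (n : ℕ) :
    (Measure.pi fun _ : Fin n => ν.withDensity fun x => ENNReal.ofReal (f x))
      = (Measure.pi fun _ : Fin n => ν).withDensity fun x => ENNReal.ofReal (∏ i, f (x i)) := by
  have : IsFiniteMeasure (ν.withDensity fun x => ENNReal.ofReal (f x)) :=
    isFiniteMeasure_withDensity_ofReal hf.2
  refine Measure.pi_eq fun s hs => ?_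
  rw [withDensity_apply _ (MeasurableSet.univ_pi hs), Measure.restrict_pi_pi,
    ← ofReal_integral_eq_lintegral_ofReal (Integrable.fintype_prod fun i => hf.mono_measure
      Measure.restrict_le_self)
      (Filter.Eventually.of_forall fun x => Finset.prod_nonneg fun i _ => hf0 _),
    integral_fintype_prod_eq_prod (fun _ => f),
    ENNReal.ofReal_prod_of_nonneg fun i _ => integral_nonneg hf0]
  refine Finset.prod_congr rfl fun i _ => ?_
  rw [withDensity_apply _ (hs i), ofReal_integral_eq_lintegral_ofReal
    (hf.mono_measure Measure.restrict_le_self) (Filter.Eventually.of_forall hf0)]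

open Real in
/-- A measure dominated by a product of one-particle densities of finite entropy does not have
entropy `-∞`. -/
theorem entropyN_ne_bot {f : Space d → ℝ} (hf0 : 0 ≤ f) (hf : Integrable f)
    (hflog : Integrable fun x => f x * |log (f x)|) {n : ℕ} {Q : Measure (Fin n → Space d)}
    [IsFiniteMeasure Q] {C : ℝ≥0∞} (hC : C ≠ ⊤)
    (hQ : Q ≤ C • Measure.pi fun _ => volume.withDensity fun x => ENNReal.ofReal (f x)) :
    entropyN n Q ≠ ⊥ := by
  set F : (Fin n → Space d) → ℝ := fun x => ∏ i, f (x i) with hF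
  have hF0 : 0 ≤ F := fun x => Finset.prod_nonneg fun i _ => hf0 _
  have hFint : Integrable F := Integrable.fintype_prod fun _ => hf
  have hpi : (C • Measure.pi fun _ : Fin n => (volume : Measure (Space d)).withDensity
      fun x => ENNReal.ofReal (f x)) = volume.withDensity fun x => C * ENNReal.ofReal (F x) := by
    rw [pi_withDensity_ofReal volume hf hf0 n, ← withDensity_smul' _ _ hC]
    rfl
  rw [hpi] at hQ
  have hac : Q ≪ volume :=
    (Measure.absolutelyContinuous_of_le hQ).trans (withDensity_absolutelyContinuous _ _)
  have hq : Q.rnDeriv volume ≤ᵐ[volume] fun x => C * ENNReal.ofReal (F x) := by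
    refine ae_le_of_forall_setLIntegral_le_of_sigmaFinite (Q.measurable_rnDeriv volume)
      fun s hs _ => ?_
    calc ∫⁻ x in s, Q.rnDeriv volume x ≤ Q s := Measure.setLIntegral_rnDeriv_le s
      _ ≤ _ := hQ s
      _ = _ := withDensity_apply _ hs
  set c : ℝ := C.toReal with hc
  have hc0 : 0 ≤ c := ENNReal.toReal_nonneg
  have hlogint : Integrable fun x => f x * log⁺ (f x) := by
    refine hflog.mono' (hf.1.mul ?_) (Filter.Eventually.of_forall fun x => ?_)
    · exact continuous_posLog.comp_aestronglyMeasurable hf.1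
    · rw [norm_of_nonneg (mul_nonneg (hf0 x) posLog_nonneg)]
      exact mul_le_mul_of_nonneg_left (max_le (abs_nonneg _) (le_abs_self _)) (hf0 x)
  -- This dominates the positive part of the entropy integrand. Each term of the sum is a product of
  -- one-particle functions, with `f * log⁺ f` in slot `j` and `f` in the others.
  have hint : Integrable fun x => c * (log⁺ (n.factorial * c) * F x
      + ∑ j, F x * log⁺ (f (x j))) := by
    refine ((hFint.const_mul _).add (integrable_finsetSum _ fun j _ => ?_)).const_mul _
    have h : Integrable fun x : Fin n → Space d =>
        ∏ i, (if i = j then fun y => f y * log⁺ (f y) else f) (x i) :=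
      Integrable.fintype_prod fun i => by split_ifs <;> assumption
    refine h.congr (Filter.Eventually.of_forall fun x => ?_)
    simp only [hF]
    rw [← Finset.mul_prod_erase _ _ (Finset.mem_univ j),
      ← Finset.mul_prod_erase Finset.univ (fun i => f (x i)) (Finset.mem_univ j)]
    rw [Finset.prod_congr rfl (g := fun i => f (x i))
      fun i hi => by rw [if_neg (Finset.ne_of_mem_erase hi)]]
    simp only [if_true]
    ring
  rw [entropyN, if_pos hac, Ne, EReal.neg_eq_bot_iff]
  refine extInt_ne_top (ne_top_of_le_ne_top hint.lintegral_lt_top.ne (lintegral_mono_ae ?_))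
  filter_upwards [hq] with x hx
  rw [EReal.toENNReal_of_ne_top (EReal.coe_ne_top _), EReal.toReal_coe]
  refine ENNReal.ofReal_le_ofReal ?_
  set q := (Q.rnDeriv volume x).toReal
  have hq0 : 0 ≤ q := ENNReal.toReal_nonneg
  have hqle : q ≤ c * F x := by
    have := ENNReal.toReal_mono (ENNReal.mul_ne_top hC ENNReal.ofReal_ne_top) hx
    rwa [ENNReal.toReal_mul, ENNReal.toReal_ofReal (hF0 x)] at this
  have hfac : (0 : ℝ) ≤ n.factorial := by positivity
  -- Unlike `t log t`, the function `t log⁺ t` is monotone on `t ≥ 0`, so the bound on `q` can be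
  -- inserted.
  calc q * log (n.factorial * q) ≤ q * log⁺ (n.factorial * q) :=
        mul_le_mul_of_nonneg_left (le_max_right _ _) hq0
    _ ≤ (c * F x) * log⁺ (n.factorial * c * F x) := by
        refine mul_le_mul hqle ?_ posLog_nonneg (mul_nonneg hc0 (hF0 x))
        refine posLog_le_posLog (by positivity) ?_
        rw [mul_assoc]
        exact mul_le_mul_of_nonneg_left hqle hfac
    _ ≤ (c * F x) * (log⁺ (n.factorial * c) + ∑ j, log⁺ (f (x j))) := by
        refine mul_le_mul_of_nonneg_left ?_ (mul_nonneg hc0 (hF0 x))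
        refine posLog_mul.trans ?_
        gcongr
        exact posLog_prod _ _
    _ = _ := by rw [← Finset.mul_sum]; ring

end Finiteness
end ClassicalGas
end

/-! ### The trial state -/

noncomputable section
namespace ClassicalGas

section Construction

variable {d : ℕ}

/-- The state that is the vacuum except for a component with `k + 1` particles. -/
theorem exists_state_single {k : ℕ} (Q : Measure (Fin (k + 1) → Space d))
    (hsym : ∀ σ : Equiv.Perm (Fin (k + 1)), Q.map (fun x i => x (σ i)) = Q)
    (hQ : Q Set.univ ≤ 1) :
    ∃ S : State d, S.P 0 = (1 - Q Set.univ) • volume ∧ S.P (k + 1) = Q ∧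
      ∀ n, n ≠ 0 → n ≠ k + 1 → S.P n = 0 := by
  let P : (n : ℕ) → Measure (Fin n → Space d) := fun n =>
    Pi.single (M := fun n => Measure (Fin n → Space d)) 0 ((1 - Q Set.univ) • volume) n +
      Pi.single (M := fun n => Measure (Fin n → Space d)) (k + 1) Q n
  have h0 : P 0 = (1 - Q Set.univ) • volume := by simp [P]
  have hk : P (k + 1) = Q := by simp [P]
  have hn : ∀ n, n ≠ 0 → n ≠ k + 1 → P n = 0 := fun n h1 h2 => by simp [P, h1, h2]
  refine ⟨⟨P, ?_, ?_⟩, h0, hk, hn⟩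
  · intro n σ
    by_cases h : n = 0
    · subst h
      have : (fun (x : Fin 0 → Space d) i => x (σ i)) = id := by
        ext x i
        exact i.elim0
      rw [this, Measure.map_id]
    · by_cases h' : n = k + 1
      · subst h'
        rw [hk, hsym]
      · rw [hn n h h', Measure.map_zero]
  · rw [tsum_eq_sum (s := {0, k + 1}) fun n hns => by
      simp only [Finset.mem_insert, Finset.mem_singleton, not_or] at hns
      rw [hn n hns.1 hns.2]; rfl]
    rw [Finset.sum_pair (by omega), h0, hk]
    have : (volume : Measure (Fin 0 → Space d)) Set.univ = 1 := by
      rw [volume_pi, Measure.pi_univ]; simp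
    rw [Measure.smul_apply, this, smul_eq_mul, mul_one, tsub_add_cancel_of_le hQ]

/-- The density of a state with one nonempty component. -/
theorem State.density_eq {S : State d} {k : ℕ} (h : ∀ n, n ≠ 0 → n ≠ k + 1 → S.P n = 0) :
    S.density = ((k + 1 : ℕ) : ℝ≥0∞) • (S.P (k + 1)).map fun x => x 0 := by
  ext s hs
  rw [State.density, Measure.sum_apply _ hs, tsum_eq_single k]
  intro n hn
  rw [h (n + 1) (by omega) (by omega)]
  simp

/-- If a measure on `(ℝ^d)^(k + 1)` is symmetric, charges only configurations of particles that
stay apart, has the prescribed one-particle density `f` and is dominated by the product of the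
one-particle densities, then the free energy at density `f` is below `+∞`. -/
theorem G_lt_top_of_measure {w : Space d → EReal} {κ r₀ s : ℝ} {α : ℝ≥0∞}
    (hw : ShortRange w κ r₀ α s) (hα : α < ⊤) {f : Space d → ℝ} (hf0 : 0 ≤ f) (hf : Integrable f)
    {T : ℝ} (hT : 0 ≤ T) (hlog : 0 < T → Integrable fun x => f x * |Real.log (f x)|)
    {k : ℕ} (Q : Measure (Fin (k + 1) → Space d))
    (hsym : ∀ σ : Equiv.Perm (Fin (k + 1)), Q.map (fun x i => x (σ i)) = Q)
    (hQ : Q Set.univ ≤ 1)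
    (hdens : ((k + 1 : ℕ) : ℝ≥0∞) • Q.map (fun x => x 0)
      = volume.withDensity fun x => ENNReal.ofReal (f x))
    {δ : ℝ} (hδ : 0 < δ) (hsep : ∀ᵐ x ∂Q, ∀ i j, i ≠ j → δ ≤ ‖x i - x j‖) {C : ℝ≥0∞}
    (hC : C ≠ ⊤)
    (hle : Q ≤ C • Measure.pi fun _ => volume.withDensity fun x => ENNReal.ofReal (f x)) :
    G w T f < ⊤ := by
  obtain ⟨S, h0, hk, hn⟩ := exists_state_single Q hsym hQ
  have hQfin : IsFiniteMeasure Q := ⟨hQ.trans_lt ENNReal.one_lt_top⟩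
  have hcle : (1 - Q Set.univ) ≠ ⊤ := ne_top_of_le_ne_top ENNReal.one_ne_top tsub_le_self
  -- All product measures over `Fin 0` coincide, so the vacuum component satisfies the same
  -- domination hypothesis as `Q`.
  have hvol : (volume : Measure (Fin 0 → Space d))
      = Measure.pi fun _ => volume.withDensity fun x => ENNReal.ofReal (f x) := by
    rw [volume_pi, Measure.pi_of_empty, Measure.pi_of_empty]
  have hfin0 : IsFiniteMeasure (S.P 0) := by
    rw [h0]
    refine ⟨?_⟩
    rw [Measure.smul_apply, volume_pi, Measure.pi_univ]
    simpa using hcle.lt_top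
  refine lt_of_le_of_lt (sInf_le ⟨S, ?_, rfl⟩) (State.freeEnergy_lt_top hT (N := k + 1) ?_ ?_ ?_)
  · rw [State.density_eq hn, hk, hdens]
  · exact fun n hnk => hn n (by omega) (by omega)
  · intro n
    by_cases h : n = 0
    · subst h
      exact interactionN_ne_top hw hα hδ (Filter.Eventually.of_forall fun x j => j.elim0)
    · by_cases h' : n = k + 1
      · subst h'
        rw [hk]
        exact interactionN_ne_top hw hα hδ hsep
      · rw [hn n h h', interactionN_zero]
        exact EReal.zero_ne_top
  · intro hT n
    by_cases h : n = 0
    · subst h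
      refine entropyN_ne_bot hf0 hf (hlog hT) hcle ?_
      rw [h0, ← hvol]
    · by_cases h' : n = k + 1
      · subst h'
        rw [hk]
        exact entropyN_ne_bot hf0 hf (hlog hT) hC hle
      · rw [hn n h h', entropyN_zero]
        exact EReal.zero_ne_bot

/-- An absolutely continuous finite measure does not charge spheres. -/
theorem nullSingletonClass_map_norm {E : Type*} [NormedAddCommGroup E] [NormedSpace ℝ E]
    [FiniteDimensional ℝ E] [MeasurableSpace E] [BorelSpace E] [Nontrivial E] {ν μ : Measure E}
    [ν.IsAddHaarMeasure] (h : μ ≪ ν) : NullSingletonClass (μ.map fun x => ‖x‖) := by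
  refine ⟨fun r => ?_⟩
  rw [Measure.map_apply measurable_norm (measurableSet_singleton r)]
  refine h ?_
  have : (fun x : E => ‖x‖) ⁻¹' {r} = Metric.sphere 0 r := by ext x; simp
  rw [this, Measure.addHaar_sphere]

/-- Finiteness of the free energy for a nonnegative density. -/
theorem G_lt_top (hd : 1 ≤ d) {w : Space d → EReal} {κ r₀ s : ℝ} {α : ℝ≥0∞}
    (hw : ShortRange w κ r₀ α s) (hα : α < ⊤) {f : Space d → ℝ} (hf0 : 0 ≤ f) (hf : Integrable f)
    {T : ℝ} (hT : 0 ≤ T) (hlog : 0 < T → Integrable fun x => f x * |Real.log (f x)|) :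
    G w T f < ⊤ := by
  set μ : Measure (Space d) := volume.withDensity fun x => ENNReal.ofReal (f x) with hμ
  have hμfin : IsFiniteMeasure μ := isFiniteMeasure_withDensity_ofReal hf.2
  by_cases h0 : μ = 0
  · refine G_lt_top_of_measure hw hα hf0 hf hT hlog (k := 0) 0 (by simp) (by simp) ?_ one_pos
      (by simp) ENNReal.zero_ne_top (Measure.zero_le _)
    rw [← hμ, h0]
    simp
  -- Here `1 ≤ d` enters: spheres, including the one of radius zero, are then Lebesgue null.
  · have : Nonempty (Fin d) := ⟨⟨0, hd⟩⟩
    have := nullSingletonClass_map_norm (ν := volume) (μ := μ)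
      (withDensity_absolutelyContinuous _ _)
    -- With `k + 1` particles and `2 (k + 1)` shells, `2 * m` equals `μ univ / (k + 1)`, which is at
    -- most `1`.
    obtain ⟨k, hk⟩ := ENNReal.exists_nat_gt (measure_ne_top μ Set.univ)
    obtain ⟨A, hAmeas, hAm, hAsum, δ, hδ, hsep⟩ := exists_shells μ h0 (K := (k + 1) * 2) (by omega)
    set m : ℝ≥0∞ := μ Set.univ / ((k + 1) * 2 : ℕ) with hm
    have hm0 : m ≠ 0 := by
      rw [hm, Ne, ENNReal.div_eq_zero_iff]
      exact not_or.2 ⟨by simpa using h0, ENNReal.natCast_ne_top _⟩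
    have hmtop : m ≠ ⊤ := ENNReal.div_ne_top (measure_ne_top _ _) (by simp)
    have h2m : 2 * m ≤ 1 := by
      have hk' : μ Set.univ ≤ (k + 1 : ℕ) := hk.le.trans (by exact_mod_cast k.le_succ)
      rw [hm, ← mul_div_assoc]
      refine ENNReal.div_le_of_le_mul ?_
      rw [one_mul, mul_comm, Nat.cast_mul]
      exact mul_le_mul_left hk' _
    -- `e` is the parity of the shell: for fixed `e`, distinct `i` give shell indices differing by
    -- at least `2`.
    set B : Fin (k + 1) → Fin 2 → Set (Space d) := fun i e => A (e + 2 * i) with hB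
    have hBm : ∀ i e, μ (B i e) = m := fun i e => hAm _ (by omega)
    have hBsum : ∑ i, ∑ e, μ.restrict (B i e) = μ := by
      rw [← Fintype.sum_prod_type' (f := fun i e => μ.restrict (B i e)),
        ← finProdFinEquiv.symm.sum_comp]
      conv_rhs => rw [← hAsum, Finset.sum_range]
      refine Finset.sum_congr rfl fun i _ => ?_
      conv_rhs => rw [← finProdFinEquiv.apply_symm_apply i]
      rfl
    -- The one-particle density of `assignMeasure μ B` is `a • μ`, hence the normalisation by `a⁻¹`.
    set a : ℝ≥0∞ := (k + 1).factorial * m ^ k with ha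
    have ha0 : a ≠ 0 := mul_ne_zero (by exact_mod_cast (Nat.factorial_ne_zero _)) (pow_ne_zero _ hm0)
    have hatop : a ≠ ⊤ := ENNReal.mul_ne_top (ENNReal.natCast_ne_top _) (ENNReal.pow_ne_top hmtop)
    refine G_lt_top_of_measure hw hα hf0 hf hT hlog (k := k) (a⁻¹ • assignMeasure μ B) ?_ ?_ ?_ hδ
      ?_ (C := a⁻¹ * ((k + 1).factorial * 2)) ?_ ?_
    · intro σ
      rw [Measure.map_smul, map_comp_perm_assignMeasure]
    · rw [Measure.smul_apply, assignMeasure_univ μ hBm, smul_eq_mul]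
      calc a⁻¹ * ((k + 1).factorial * (2 * m ^ (k + 1))) = (a⁻¹ * a) * (2 * m) := by
            rw [ha]; ring
        _ ≤ 1 := by rwa [ENNReal.inv_mul_cancel ha0 hatop, one_mul]
    · have h := sum_map_eval_assignMeasure μ hBm hBsum
      simp only [fun j => map_eval_assignMeasure μ (B := B) j 0, Finset.sum_const,
        Finset.card_univ, Fintype.card_fin, Nat.add_sub_cancel] at h
      rw [Measure.map_smul, smul_comm, Nat.cast_smul_eq_nsmul, h, smul_smul,
        ENNReal.inv_mul_cancel ha0 hatop, one_smul]
    · refine Measure.ae_smul_measure (ae_assignMeasure μ (B := B) (p := fun x y => δ ≤ ‖x - y‖)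
        (fun i e => hAmeas _) ?_) _
      have key : ∀ (e : Fin 2) (i j : Fin (k + 1)), i < j → ∀ x ∈ B i e, ∀ y ∈ B j e,
          δ ≤ ‖x - y‖ := fun e i j hij x hx y hy =>
        hsep (e + 2 * i) (e + 2 * j) (by have := Fin.lt_def.1 hij; omega) (by omega) x hx y hy
      intro e i j hij x hx y hy
      rcases hij.lt_or_gt with h | h
      · exact key e i j h x hx y hy
      · rw [norm_sub_rev]
        exact key e j i h y hy x hx
    · exact ENNReal.mul_ne_top (ENNReal.inv_ne_top.2 ha0)
        (ENNReal.mul_ne_top (ENNReal.natCast_ne_top _) ENNReal.ofNat_ne_top)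
    · rw [← smul_smul]
      intro s
      exact mul_le_mul_right (assignMeasure_le μ (B := B) s) _

end Construction
end ClassicalGas
end

theorem corollary2p2 {d : ℕ} (hd : 1 ≤ d)
    {w : ClassicalGas.Space d → EReal} {κ r₀ s : ℝ} {α : ENNReal}
    (hw : ClassicalGas.ShortRange w κ r₀ α s) (hα : α < ⊤)
    {ρ : ClassicalGas.Space d → ℝ}
    (hρ_nonneg : 0 ≤ᵐ[MeasureTheory.volume] ρ)
    (hρ_int : MeasureTheory.Integrable ρ MeasureTheory.volume) :
    ClassicalGas.G w 0 ρ < ⊤ ∧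
      (MeasureTheory.Integrable (fun x => ρ x * |Real.log (ρ x)|) MeasureTheory.volume →
        ∀ T : ℝ, 0 < T → ClassicalGas.G w T ρ < ⊤) := by
  -- `ρ` is nonnegative only almost everywhere, while the construction uses a pointwise nonnegative
  -- density; `G` sees only the almost everywhere class.
  set f : ClassicalGas.Space d → ℝ := fun x => max (ρ x) 0 with hf
  have hρf : ρ =ᵐ[volume] f := by
    filter_upwards [hρ_nonneg] with x hx
    exact (max_eq_left hx).symm
  have hf0 : 0 ≤ f := fun x => le_max_right _ _
  have hG : ∀ T, ClassicalGas.G w T ρ = ClassicalGas.G w T f := by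
    intro T
    simp only [ClassicalGas.G]
    rw [withDensity_congr_ae (g := fun x => ENNReal.ofReal (f x))]
    filter_upwards [hρf] with x hx
    rw [hx]
  have hfint : Integrable f := hρ_int.congr hρf
  simp only [hG]
  refine ⟨ClassicalGas.G_lt_top hd hw hα hf0 hfint le_rfl fun h => absurd h (lt_irrefl _),
    fun hlog T hT => ClassicalGas.G_lt_top hd hw hα hf0 hfint hT.le fun _ => hlog.congr ?_⟩
  filter_upwards [hρf] with x hx
  rw [hx]
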